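/- Let $H\in\mathbb{R}^{M\times N}$, let $t_i\le t_f$ and $t_a$ be integer times, and let $a\in\mathbb{R}^M$ be an (unknown) attack vector. Consider the measurements $$y^s = Hx^s-\theta^s a+e^s\in\mathbb{R}^M,\qquad s=t_i,\dots,t_f,$$ where $\theta^s=0$ for $s<t_a$ and $\theta^s=1$ for $s\ge t_a$. Assume that the state sequence $x^s\in\mathbb{R}^N$ (deterministic or random) has variations bounded by $\gamma$, i.e. $\|x^s-x^{s'}\|_2\le\gamma$ (almost surely) for all $s,s'\in\{t_i,\dots,t_f\}$, and that all the entries $e^s_k$ of the noise vectors ($t_i\le s\le t_f$, $1\le k\le M$) are independent Gaussian random variables with mean $0$ and variance $\nu^2$, where $\nu>0$. For a window size $w$ let $$\Delta^t=\big[\,y^t-y^{t-1},\ y^t-y^{t-2},\ \dots,\ y^t-y^{t-w}\,\big]\in\mathbb{R}^{M\times w}$$ be the history matrix, and let $\sigma_1(\Delta^t)$ be its largest singular value. Let $\tau>0$ and $\epsilon>0$. Then for every time $t$ before the attack whose window lies in the time interval, i.e. $t_i+w\le t\le t_f$ and $t<t_a$, $$\mathbb{P}\big(\sigma_1(\Delta^t)\ge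 \ell\big)\le 2\exp\Big(-\frac{\tau^2}{2}\Big)+\big((1+\epsilon)e^{-\epsilon}\big)^{M/2},$$ where $$\ell=\nu\sqrt{w}\sqrt{M}(1+\epsilon)+\nu\big(\sqrt{M}+\sqrt{w}+\tau\big)+\gamma\sqrt{w}\,\|H\|$$ and $\|H\|$ is the spectral norm (the operator norm for the Euclidean norms). -/

import Mathlib

open MeasureTheory ProbabilityTheory

/-- The indicator `θ^t` of an abrupt attack at time `ta`: `0` for `t < ta` and `1` for `t ≥ ta`. -/
noncomputable def attackIndicator (ta t : ℤ) : ℝ := if t < ta then 0 else 1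

/-- The measurement vector `y^t = H x^t - θ^t a + e^t` of the linear model under attack, for a
realization `x`, `e` of the state sequence and of the noise sequence. -/
noncomputable def measurement {M N : ℕ} (H : Matrix (Fin M) (Fin N) ℝ)
    (a : EuclideanSpace ℝ (Fin M)) (ta : ℤ)
    (x : ℤ → EuclideanSpace ℝ (Fin N)) (e : ℤ → EuclideanSpace ℝ (Fin M)) (t : ℤ) :
    EuclideanSpace ℝ (Fin M) :=
  Matrix.toEuclideanLin H (x t) - attackIndicator ta t • a + e t

/-- The history matrix `Δ^t` of a sequence `y` of measurements with window size `w`: the `M × w`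
matrix whose columns are `y^t - y^(t-1), …, y^t - y^(t-w)`. -/
noncomputable def historyMatrix {M : ℕ} (y : ℤ → EuclideanSpace ℝ (Fin M)) (w : ℕ) (t : ℤ) :
    Matrix (Fin M) (Fin w) ℝ :=
  Matrix.of fun i j => (y t - y (t - ((j : ℕ) + 1 : ℤ))) i

/-- The largest singular value `σ₁` of a real matrix (Mathlib's singular values are listed in
decreasing order, starting with index `0`). -/
noncomputable def sigmaOne {M w : ℕ} (A : Matrix (Fin M) (Fin w) ℝ) : ℝ :=
  (Matrix.toEuclideanLin A).singularValues 0

/-- The spectral norm `‖H‖`: the operator norm of `H` for the Euclidean norms. -/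
noncomputable def spectralNorm₂ {M N : ℕ} (H : Matrix (Fin M) (Fin N) ℝ) : ℝ :=
  ‖LinearMap.toContinuousLinearMap (Matrix.toEuclideanLin H)‖

/-- White Gaussian noise of variance `ν²` on the time interval `{ti, …, tf}`: all the entries
`e^s_i`, with `s` in the interval and `i` a coordinate, are independent, with law `N(0, ν²)`. -/
structure IsWhiteGaussianNoise {Ω : Type*} [MeasurableSpace Ω] {M : ℕ} (P : Measure Ω)
    (ti tf : ℤ) (ν : ℝ) (e : ℤ → Ω → EuclideanSpace ℝ (Fin M)) : Prop where
  hasLaw : ∀ s ∈ Set.Icc ti tf, ∀ i : Fin M,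
    HasLaw (fun ω => e s ω i) (gaussianReal 0 (ν ^ 2).toNNReal) P
  indep : iIndepFun (fun (k : Set.Icc ti tf × Fin M) (ω : Ω) => e k.1 ω k.2) P

/-- The state varies by at most `γ` in Euclidean norm over the time interval `{ti, …, tf}`, almost
surely (for a deterministic state sequence: `‖x^s - x^s'‖ ≤ γ` for all times `s`, `s'`). -/
def HasBoundedVariations {Ω : Type*} [MeasurableSpace Ω] {N : ℕ} (P : Measure Ω)
    (ti tf : ℤ) (γ : ℝ) (x : ℤ → Ω → EuclideanSpace ℝ (Fin N)) : Prop :=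
  ∀ s ∈ Set.Icc ti tf, ∀ s' ∈ Set.Icc ti tf, ∀ᵐ ω ∂P, ‖x s ω - x s' ω‖ ≤ γ

/-- The threshold `ℓ = ν√w√M(1+ε) + ν(√M+√w+τ) + γ√w‖H‖`. -/
noncomputable def detectionThreshold {M N : ℕ} (H : Matrix (Fin M) (Fin N) ℝ) (w : ℕ)
    (ν γ τ ε : ℝ) : ℝ :=
  ν * √(w : ℝ) * √(M : ℝ) * (1 + ε) + ν * (√(M : ℝ) + √(w : ℝ) + τ)
    + γ * √(w : ℝ) * spectralNorm₂ H

/-!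
# Largest singular value of the history matrix before an attack

Before the attack every column of the history matrix is
`H (xᵗ - xᵗ⁻ʲ) + eᵗ - eᵗ⁻ʲ`, hence
`σ₁(Δᵗ) ≤ √w (‖H‖ γ + ‖eᵗ‖) + ‖E‖`, where the columns of `E` are the `w` past noise vectors
(`sigmaOne_historyMatrix_le`). The norm `‖eᵗ‖` is controlled by the Chernoff bound for the
chi-square law (`measureReal_card_mul_le_sum_sq`), and `‖E‖` by the Davidson–Szarek inequality
`ℙ(‖G‖ ≥ √M + √w + τ) ≤ exp (-τ² / 2)` for a standard Gaussian matrix `G`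
(`measureReal_le_spectralNorm₂`). A union bound concludes.

The Davidson–Szarek inequality is obtained from a single exponential moment. For unit vectors
`u`, `v` the process `uᵀ G v + z`, with `z` an independent standard Gaussian variable, has the
same variances as `⟪u, g⟫ + ⟪v, h⟫`, with `g`, `h` standard Gaussian vectors, and larger
covariances. Gaussian comparison (`integral_expSum_rpow_le_of_covariance_le`) therefore gives
`𝔼 exp (l ‖G‖) · exp (l² / 2) ≤ 𝔼 exp (l ‖g‖) · 𝔼 exp (l ‖h‖)`, and
`𝔼 exp (l ‖g‖) ≤ exp (l √M + l² / 2)` (`integral_exp_mul_sqrt_sum_sq_le`), so that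
`𝔼 exp (l ‖G‖) ≤ exp (l (√M + √w) + l² / 2)`; the Chernoff bound with `l = τ` is the claim. The
supremum over `u`, `v` is replaced by a maximum over finite nets, and the maximum by the smooth
functional `(∑ i, exp (l / p * x i)) ^ p` with `p → 0`.

The comparison itself is proved by interpolation between the two processes; the derivative is
computed with Stein's identity `𝔼 ξₖ f(ξ) = 𝔼 ∂ₖ f(ξ)` (`integral_coord_mul_stdGaussianPi`).
-/

/-! ### Gaussian integration by parts -/

/-- The standard Gaussian measure on `κ → ℝ`: the coordinates are independent with law `N(0, 1)`. -/
noncomputable abbrev stdGaussianPi (κ : Type*) [Fintype κ] : Measure (κ → ℝ) :=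
  Measure.pi fun _ => gaussianReal 0 1

theorem integrable_exp_mul_abs_gaussianReal (b : ℝ) :
    Integrable (fun s : ℝ => Real.exp (b * |s|)) (gaussianReal 0 1) :=
  integrable_exp_mul_abs (X := id) (integrable_exp_mul_gaussianReal b)
    (integrable_exp_mul_gaussianReal (-b))

theorem integrable_exp_mul_sum_abs {κ : Type*} [Fintype κ] (b : ℝ) :
    Integrable (fun ξ : κ → ℝ => Real.exp (b * ∑ k, |ξ k|)) (stdGaussianPi κ) := by
  simp_rw [Finset.mul_sum, Real.exp_sum]
  exact Integrable.fintype_prod (f := fun _ s => Real.exp (b * |s|))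
    fun _ => integrable_exp_mul_abs_gaussianReal b

/-- Stein's identity in dimension one. -/
theorem integral_id_mul_gaussianReal {f f' : ℝ → ℝ} (hf : ∀ s, HasDerivAt f (f' s) s)
    (h0 : Integrable f (gaussianReal 0 1)) (h1 : Integrable (fun s => s * f s) (gaussianReal 0 1))
    (h2 : Integrable f' (gaussianReal 0 1)) :
    ∫ s, s * f s ∂gaussianReal 0 1 = ∫ s, f' s ∂gaussianReal 0 1 := by
  have hI : ∀ g : ℝ → ℝ, Integrable g (gaussianReal 0 1) →
      Integrable (fun s => g s * gaussianPDFReal 0 1 s) := by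
    intro g hg
    rw [gaussianReal_of_var_ne_zero 0 one_ne_zero,
      integrable_withDensity_iff (measurable_gaussianPDF _ _) (by simp [gaussianPDF])] at hg
    simpa [toReal_gaussianPDF] using hg
  have hd : ∀ s : ℝ, HasDerivAt (gaussianPDFReal 0 1) (-s * gaussianPDFReal 0 1 s) s := by
    intro s
    have h : HasDerivAt (fun s : ℝ => -(s - 0) ^ 2 / (2 * ((1 : NNReal) : ℝ))) (-s) s := by
      have := ((hasDerivAt_id s).pow 2).neg.div_const 2
      simp only [sub_zero, NNReal.coe_one, mul_one]
      refine this.congr_deriv ?_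
      simp; ring
    refine ((h.exp).const_mul ((√(2 * Real.pi * ((1 : NNReal) : ℝ)))⁻¹)).congr_deriv ?_
    rw [gaussianPDFReal_def]
    ring
  have key := integral_mul_deriv_eq_deriv_mul_of_integrable (u := f) (v := gaussianPDFReal 0 1)
    (u' := f') (v' := fun s => -s * gaussianPDFReal 0 1 s) (fun s _ => hf s) (fun s _ => hd s)
    (by
      refine (hI _ h1).neg.congr (Filter.Eventually.of_forall fun s => ?_)
      simp; ring)
    (hI _ h2) (hI _ h0)
  rw [integral_gaussianReal_eq_integral_smul one_ne_zero,
    integral_gaussianReal_eq_integral_smul one_ne_zero]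
  simp only [smul_eq_mul]
  calc ∫ s, gaussianPDFReal 0 1 s * (s * f s)
      = -∫ s, f s * (-s * gaussianPDFReal 0 1 s) := by
        rw [← integral_neg]; congr 1; ext s; ring
    _ = ∫ s, gaussianPDFReal 0 1 s * f' s := by
        rw [key, neg_neg]; congr 1; ext s; ring

/-- Resampling one coordinate of a product of probability measures leaves the product unchanged. -/
theorem measurePreserving_update_pi {κ : Type*} [Fintype κ] [DecidableEq κ] {μ : Measure ℝ}
    [IsProbabilityMeasure μ] (k : κ) :
    MeasurePreserving (fun z : (κ → ℝ) × ℝ => Function.update z.1 k z.2)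
      ((Measure.pi fun _ : κ => μ).prod μ) (Measure.pi fun _ : κ => μ) := by
  have hm : Measurable (fun z : (κ → ℝ) × ℝ => Function.update z.1 k z.2) := by
    rw [measurable_pi_iff]
    intro j
    by_cases h : j = k
    · subst h; simpa using measurable_snd
    · simp only [Function.update_of_ne h]; fun_prop
  refine ⟨hm, (Measure.pi_eq fun s hs => ?_).symm⟩
  have hpre : (fun z : (κ → ℝ) × ℝ => Function.update z.1 k z.2) ⁻¹' (Set.univ.pi s) =
      (Set.univ.pi (Function.update s k Set.univ)) ×ˢ (s k) := by
    ext z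
    simp only [Set.mem_preimage, Set.mem_pi, Set.mem_univ, forall_true_left, Set.mem_prod]
    constructor
    · intro h
      refine ⟨fun j => ?_, by simpa using h k⟩
      by_cases hj : j = k
      · subst hj; simp
      · simpa [hj] using h j
    · rintro ⟨h, hk⟩ j
      by_cases hj : j = k
      · subst hj; simpa using hk
      · simpa [hj] using h j
  rw [Measure.map_apply hm (MeasurableSet.univ_pi hs), hpre, Measure.prod_prod, Measure.pi_pi,
    ← Finset.mul_prod_erase _ _ (Finset.mem_univ k),
    ← Finset.mul_prod_erase Finset.univ (fun j => μ (s j)) (Finset.mem_univ k)]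
  have : ∏ j ∈ Finset.univ.erase k, μ (Function.update s k Set.univ j) =
      ∏ j ∈ Finset.univ.erase k, μ (s j) :=
    Finset.prod_congr rfl fun j hj => by rw [Function.update_of_ne (Finset.ne_of_mem_erase hj)]
  rw [this]
  simp [mul_comm]

/-- Stein's identity (Gaussian integration by parts) in the coordinate `k`. -/
theorem integral_coord_mul_stdGaussianPi {κ : Type*} [Fintype κ] [DecidableEq κ] (k : κ)
    {f f' : (κ → ℝ) → ℝ}
    (hf : ∀ ξ s, HasDerivAt (fun s => f (Function.update ξ k s)) (f' (Function.update ξ k s)) s)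
    (h0 : Integrable f (stdGaussianPi κ))
    (h1 : Integrable (fun ξ => ξ k * f ξ) (stdGaussianPi κ))
    (h2 : Integrable f' (stdGaussianPi κ)) :
    ∫ ξ, ξ k * f ξ ∂stdGaussianPi κ = ∫ ξ, f' ξ ∂stdGaussianPi κ := by
  have mp := measurePreserving_update_pi (μ := gaussianReal 0 1) k
  have hI : ∀ g : (κ → ℝ) → ℝ, Integrable g (stdGaussianPi κ) →
      Integrable (fun z : (κ → ℝ) × ℝ => g (Function.update z.1 k z.2))
        ((stdGaussianPi κ).prod (gaussianReal 0 1)) := fun g hg => mp.integrable_comp_of_integrable hg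
  have hE : ∀ g : (κ → ℝ) → ℝ, Integrable g (stdGaussianPi κ) →
      ∫ ξ, g ξ ∂stdGaussianPi κ =
        ∫ ξ, ∫ s, g (Function.update ξ k s) ∂gaussianReal 0 1 ∂stdGaussianPi κ := by
    intro g hg
    rw [← integral_prod (fun z : (κ → ℝ) × ℝ => g (Function.update z.1 k z.2)) (hI g hg),
      ← integral_map mp.measurable.aemeasurable (by rw [mp.map_eq]; exact hg.aestronglyMeasurable),
      mp.map_eq]
  rw [hE _ h1, hE _ h2]
  refine integral_congr_ae ?_
  filter_upwards [(hI _ h0).prod_right_ae, (hI _ h1).prod_right_ae, (hI _ h2).prod_right_ae]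
    with ξ a0 a1 a2
  simp only [Function.update_self] at a1 ⊢
  exact integral_id_mul_gaussianReal (hf ξ) a0 a1 a2

/-! ### Powers of exponential sums -/

/-- The exponential sum `∑ i, exp (β x i)`. -/
noncomputable def expSum {ι : Type*} [Fintype ι] (β : ℝ) (x : ι → ℝ) : ℝ :=
  ∑ i, Real.exp (β * x i)

/-- The partial derivative `∂ᵢ (expSum β x ^ p)`, up to the factor `p * β`. -/
noncomputable def expSumGrad {ι : Type*} [Fintype ι] (p β : ℝ) (x : ι → ℝ) (i : ι) : ℝ :=
  expSum β x ^ (p - 1) * Real.exp (β * x i)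

/-- The partial derivative `∂ⱼ (expSumGrad p β x i)`. -/
noncomputable def expSumHess {ι : Type*} [Fintype ι] [DecidableEq ι] (p β : ℝ) (x : ι → ℝ)
    (i j : ι) : ℝ :=
  β * ((p - 1) * (expSum β x ^ (p - 2) * (Real.exp (β * x i) * Real.exp (β * x j))) +
    if i = j then expSumGrad p β x i else 0)

section ExpSum

variable {ι : Type*} [Fintype ι] {p β : ℝ}

@[fun_prop]
theorem continuous_expSum : Continuous (expSum β : (ι → ℝ) → ℝ) := by
  unfold expSum; fun_prop

theorem exp_le_expSum (x : ι → ℝ) (i : ι) : Real.exp (β * x i) ≤ expSum β x :=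
  Finset.single_le_sum (f := fun i => Real.exp (β * x i)) (fun _ _ => (Real.exp_pos _).le)
    (Finset.mem_univ i)

theorem hasDerivAt_expSum {x : ℝ → ι → ℝ} {x' : ι → ℝ} {s : ℝ}
    (hx : ∀ i, HasDerivAt (fun s => x s i) (x' i) s) :
    HasDerivAt (fun s => expSum β (x s)) (β * ∑ i, x' i * Real.exp (β * x s i)) s := by
  refine (HasDerivAt.fun_sum fun i _ => ((hx i).const_mul β).exp).congr_deriv ?_
  rw [Finset.mul_sum]
  exact Finset.sum_congr rfl fun i _ => by ring

variable [Nonempty ι]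

theorem expSum_pos (x : ι → ℝ) : 0 < expSum β x :=
  Finset.sum_pos (fun _ _ => Real.exp_pos _) Finset.univ_nonempty

theorem continuous_expSum_rpow (p : ℝ) : Continuous fun x : ι → ℝ => expSum β x ^ p :=
  continuous_expSum.rpow_const fun x => Or.inl (expSum_pos x).ne'

theorem continuous_expSumGrad (i : ι) : Continuous fun x : ι → ℝ => expSumGrad p β x i :=
  (continuous_expSum_rpow _).mul (by fun_prop)

theorem continuous_expSumHess [DecidableEq ι] (i j : ι) :
    Continuous fun x : ι → ℝ => expSumHess p β x i j := by
  unfold expSumHess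
  refine continuous_const.mul (.add (continuous_const.mul ((continuous_expSum_rpow _).mul
    (by fun_prop))) ?_)
  split_ifs
  · exact continuous_expSumGrad i
  · exact continuous_const

theorem hasDerivAt_expSum_rpow {x : ℝ → ι → ℝ} {x' : ι → ℝ} {s : ℝ}
    (hx : ∀ i, HasDerivAt (fun s => x s i) (x' i) s) :
    HasDerivAt (fun s => expSum β (x s) ^ p)
      (p * β * ∑ i, x' i * expSumGrad p β (x s) i) s := by
  refine ((hasDerivAt_expSum (β := β) hx).rpow_const (p := p)
    (Or.inl (expSum_pos (x s)).ne')).congr_deriv ?_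
  simp only [expSumGrad, Finset.mul_sum, Finset.sum_mul]
  exact Finset.sum_congr rfl fun i _ => by ring

theorem hasDerivAt_expSumGrad [DecidableEq ι] {x : ℝ → ι → ℝ} {x' : ι → ℝ} {s : ℝ}
    (hx : ∀ i, HasDerivAt (fun s => x s i) (x' i) s) (i : ι) :
    HasDerivAt (fun s => expSumGrad p β (x s) i) (∑ j, x' j * expSumHess p β (x s) i j) s := by
  refine (((hasDerivAt_expSum (β := β) hx).rpow_const (p := p - 1)
    (Or.inl (expSum_pos (x s)).ne')).mul ((hx i).const_mul β).exp).congr_deriv ?_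
  simp only [expSumHess, mul_add, Finset.sum_add_distrib, mul_ite, mul_zero, Finset.sum_ite_eq,
    Finset.mem_univ, if_true, expSumGrad, Finset.mul_sum, Finset.sum_mul]
  congr 1
  · refine Finset.sum_congr rfl fun j _ => ?_
    rw [show p - 1 - 1 = p - 2 by ring]; ring
  · ring

theorem expSumGrad_nonneg (x : ι → ℝ) (i : ι) : 0 ≤ expSumGrad p β x i :=
  mul_nonneg (Real.rpow_nonneg (expSum_pos x).le _) (Real.exp_pos _).le

theorem expSumGrad_le (x : ι → ℝ) (i : ι) : expSumGrad p β x i ≤ expSum β x ^ p := by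
  have h := expSum_pos (β := β) x
  calc expSumGrad p β x i ≤ expSum β x ^ (p - 1) * expSum β x :=
        mul_le_mul_of_nonneg_left (exp_le_expSum x i) (Real.rpow_nonneg h.le _)
    _ = expSum β x ^ p := by rw [← Real.rpow_add_one h.ne', sub_add_cancel]

theorem expSumHess_nonpos_of_ne [DecidableEq ι] (hβ : 0 ≤ β) (hp : p ≤ 1) (x : ι → ℝ) {i j : ι}
    (hij : i ≠ j) : expSumHess p β x i j ≤ 0 := by
  have h := expSum_pos (β := β) x
  simp only [expSumHess, hij, if_false, add_zero]
  refine mul_nonpos_of_nonneg_of_nonpos hβ (mul_nonpos_of_nonpos_of_nonneg (by linarith) ?_)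
  have := Real.rpow_nonneg h.le (p - 2)
  positivity

theorem abs_expSumHess_le [DecidableEq ι] (hβ : 0 ≤ β) (hp0 : 0 ≤ p) (hp : p ≤ 1) (x : ι → ℝ)
    (i j : ι) : |expSumHess p β x i j| ≤ β * (2 * expSum β x ^ p) := by
  have h := expSum_pos (β := β) x
  have h1 : expSum β x ^ (p - 2) * (Real.exp (β * x i) * Real.exp (β * x j)) ≤
      expSum β x ^ p := by
    calc _ ≤ expSum β x ^ (p - 2) * (expSum β x * expSum β x) := by
          have := Real.rpow_nonneg h.le (p - 2)
          gcongr <;> exact exp_le_expSum x _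
      _ = expSum β x ^ p := by
          rw [← sq, ← Real.rpow_natCast, ← Real.rpow_add h]; norm_num
  have h0 : 0 ≤ expSum β x ^ (p - 2) * (Real.exp (β * x i) * Real.exp (β * x j)) := by
    have := Real.rpow_nonneg h.le (p - 2)
    positivity
  have h2 : |if i = j then expSumGrad p β x i else 0| ≤ expSum β x ^ p := by
    split_ifs
    · rw [abs_of_nonneg (expSumGrad_nonneg x i)]; exact expSumGrad_le x i
    · simpa using Real.rpow_nonneg h.le p
  rw [expSumHess, abs_mul, abs_of_nonneg hβ]
  refine mul_le_mul_of_nonneg_left ((abs_add_le _ _).trans ?_) hβ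
  rw [abs_mul, abs_of_nonneg h0, abs_of_nonpos (by linarith : p - 1 ≤ 0)]
  nlinarith

/-- Growth at most exponential, which makes the Gaussian integrals of the functional and of its
derivatives converge. -/
theorem expSum_rpow_le {κ : Type*} [Fintype κ] (hβ : 0 ≤ β) (hp0 : 0 ≤ p) (hp : p ≤ 1)
    {C : ι → κ → ℝ} {c : ℝ} (hC : ∀ i k, |C i k| ≤ c) (ξ : κ → ℝ) :
    expSum β (fun i => ∑ k, C i k * ξ k) ^ p ≤
      (1 + Fintype.card ι) * Real.exp (β * c * ∑ k, |ξ k|) := by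
  set S := expSum β (fun i => ∑ k, C i k * ξ k) with hS
  have hpos : 0 < S := expSum_pos _
  have hc : 0 ≤ β * c * ∑ k, |ξ k| := by
    rw [mul_assoc, Finset.mul_sum]
    exact mul_nonneg hβ (Finset.sum_nonneg fun k _ => mul_nonneg
      ((abs_nonneg _).trans (hC (Classical.arbitrary ι) k)) (abs_nonneg _))
  have h1 : S ^ p ≤ 1 + S := by
    rcases le_total S 1 with h | h
    · linarith [Real.rpow_le_one hpos.le h hp0]
    · linarith [Real.rpow_le_self_of_one_le h hp]
  have h2 : S ≤ Fintype.card ι * Real.exp (β * c * ∑ k, |ξ k|) := by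
    rw [hS, expSum, ← nsmul_eq_mul, ← Finset.card_univ]
    refine Finset.sum_le_card_nsmul _ _ _ fun i _ => Real.exp_le_exp.2 ?_
    rw [mul_assoc]
    refine mul_le_mul_of_nonneg_left ?_ hβ
    rw [Finset.mul_sum]
    refine Finset.sum_le_sum fun k _ => (le_abs_self _).trans ?_
    rw [abs_mul]
    exact mul_le_mul_of_nonneg_right (hC i k) (abs_nonneg _)
  have h3 : 1 ≤ Real.exp (β * c * ∑ k, |ξ k|) := Real.one_le_exp hc
  linarith

end ExpSum

/-! ### Gaussian comparison -/

theorem integrable_of_abs_le_exp_sum_abs {κ : Type*} [Fintype κ] {f : (κ → ℝ) → ℝ} {K b : ℝ}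
    (hf : Continuous f) (h : ∀ ξ, |f ξ| ≤ K * Real.exp (b * ∑ k, |ξ k|)) :
    Integrable f (stdGaussianPi κ) :=
  ((integrable_exp_mul_sum_abs b).const_mul K).mono' hf.aestronglyMeasurable
    (Filter.Eventually.of_forall h)

theorem abs_coord_le_exp_sum_abs {κ : Type*} [Fintype κ] (ξ : κ → ℝ) (k : κ) :
    |ξ k| ≤ Real.exp (∑ k, |ξ k|) :=
  (Finset.single_le_sum (f := fun k => |ξ k|) (fun _ _ => abs_nonneg _) (Finset.mem_univ k)).trans
    ((le_add_of_nonneg_right zero_le_one).trans (Real.add_one_le_exp _))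

section Comparison

variable {ι κ : Type*} [Fintype ι] [Fintype κ] {p β : ℝ}

theorem abs_entry_le_sum (C : ι → κ → ℝ) (i : ι) (k : κ) : |C i k| ≤ ∑ i, ∑ k, |C i k| :=
  (Finset.single_le_sum (f := fun k => |C i k|) (fun _ _ => abs_nonneg _)
    (Finset.mem_univ k)).trans
    (Finset.single_le_sum (f := fun i => ∑ k, |C i k|)
      (fun _ _ => Finset.sum_nonneg fun _ _ => abs_nonneg _) (Finset.mem_univ i))

variable [Nonempty ι]

theorem integrable_expSum_rpow (hβ : 0 ≤ β) (hp0 : 0 ≤ p) (hp : p ≤ 1) (C : ι → κ → ℝ) :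
    Integrable (fun ξ : κ → ℝ => expSum β (fun i => ∑ k, C i k * ξ k) ^ p) (stdGaussianPi κ) := by
  refine integrable_of_abs_le_exp_sum_abs (K := 1 + Fintype.card ι)
    (b := β * ∑ i, ∑ k, |C i k|) ((continuous_expSum_rpow p).comp (by fun_prop))
    fun ξ => ?_
  rw [abs_of_nonneg (Real.rpow_nonneg (expSum_pos _).le _)]
  exact expSum_rpow_le hβ hp0 hp (abs_entry_le_sum C) ξ

theorem integrable_expSumGrad (hβ : 0 ≤ β) (hp0 : 0 ≤ p) (hp : p ≤ 1) (C : ι → κ → ℝ) (i : ι) :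
    Integrable (fun ξ : κ → ℝ => expSumGrad p β (fun i => ∑ k, C i k * ξ k) i)
      (stdGaussianPi κ) :=
  (integrable_expSum_rpow hβ hp0 hp C).mono'
    ((continuous_expSumGrad i).comp (by fun_prop)).aestronglyMeasurable
    (Filter.Eventually.of_forall fun ξ => by
      rw [Real.norm_eq_abs, abs_of_nonneg (expSumGrad_nonneg _ _)]; exact expSumGrad_le _ _)

theorem integrable_coord_mul_expSumGrad (hβ : 0 ≤ β) (hp0 : 0 ≤ p) (hp : p ≤ 1)
    (C : ι → κ → ℝ) (i : ι) (k : κ) :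
    Integrable (fun ξ : κ → ℝ => ξ k * expSumGrad p β (fun i => ∑ k, C i k * ξ k) i)
      (stdGaussianPi κ) := by
  refine integrable_of_abs_le_exp_sum_abs (K := 1 + Fintype.card ι)
    (b := 1 + β * ∑ i, ∑ k, |C i k|)
    ((continuous_apply k).mul ((continuous_expSumGrad i).comp (by fun_prop))) fun ξ => ?_
  rw [abs_mul, abs_of_nonneg (expSumGrad_nonneg _ _), one_add_mul (β * _), Real.exp_add,
    mul_left_comm]
  exact mul_le_mul (abs_coord_le_exp_sum_abs ξ k)
    ((expSumGrad_le _ _).trans (expSum_rpow_le hβ hp0 hp (abs_entry_le_sum C) ξ))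
    (expSumGrad_nonneg _ _) (Real.exp_pos _).le

theorem integrable_expSumHess [DecidableEq ι] (hβ : 0 ≤ β) (hp0 : 0 ≤ p) (hp : p ≤ 1) (C : ι → κ → ℝ) (i j : ι) :
    Integrable (fun ξ : κ → ℝ => expSumHess p β (fun i => ∑ k, C i k * ξ k) i j)
      (stdGaussianPi κ) :=
  (((integrable_expSum_rpow hβ hp0 hp C).const_mul 2).const_mul β).mono'
    ((continuous_expSumHess i j).comp (by fun_prop)).aestronglyMeasurable
    (Filter.Eventually.of_forall fun ξ => abs_expSumHess_le hβ hp0 hp _ _ _)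

theorem integral_coord_mul_expSumGrad [DecidableEq ι] (hβ : 0 ≤ β) (hp0 : 0 ≤ p) (hp : p ≤ 1)
    (C : ι → κ → ℝ) (i : ι) (k : κ) :
    ∫ ξ, ξ k * expSumGrad p β (fun i => ∑ k, C i k * ξ k) i ∂stdGaussianPi κ =
      ∑ j, C j k * ∫ ξ, expSumHess p β (fun i => ∑ k, C i k * ξ k) i j ∂stdGaussianPi κ := by
  classical
  have hi : ∀ j, Integrable
      (fun ξ : κ → ℝ => C j k * expSumHess p β (fun i => ∑ k, C i k * ξ k) i j)
      (stdGaussianPi κ) := fun j => (integrable_expSumHess hβ hp0 hp C i j).const_mul _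
  rw [integral_coord_mul_stdGaussianPi k
    (f' := fun ξ => ∑ j, C j k * expSumHess p β (fun i => ∑ k, C i k * ξ k) i j) ?_
    (integrable_expSumGrad hβ hp0 hp C i) (integrable_coord_mul_expSumGrad hβ hp0 hp C i k)
    (integrable_finsetSum _ fun j _ => hi j), integral_finsetSum _ fun j _ => hi j]
  · simp_rw [integral_const_mul]
  · intro ξ s
    refine hasDerivAt_expSumGrad (fun j => ?_) i
    have h := hasDerivAt_pi.1 (hasDerivAt_update ξ k s)
    refine (HasDerivAt.fun_sum fun l _ => (h l).const_mul (C j l)).congr_deriv ?_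
    simp [Pi.single_apply]

/-- The derivative of the expectation of `(∑ i, exp (β (C θ ξ) i)) ^ p` along a path `C` of
matrices. -/
theorem hasDerivAt_integral_expSum_rpow (hβ : 0 ≤ β) (hp0 : 0 ≤ p) (hp : p ≤ 1)
    {C C' : ℝ → ι → κ → ℝ} {c : ℝ} (hc0 : 0 ≤ c) (hC : ∀ θ i k, |C θ i k| ≤ c)
    (hC' : ∀ θ i k, |C' θ i k| ≤ c)
    (hd : ∀ θ i k, HasDerivAt (fun θ => C θ i k) (C' θ i k) θ) (θ : ℝ) :
    HasDerivAt (fun θ => ∫ ξ, expSum β (fun i => ∑ k, C θ i k * ξ k) ^ p ∂stdGaussianPi κ)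
      (∫ ξ, p * β * ∑ i, (∑ k, C' θ i k * ξ k) *
        expSumGrad p β (fun i => ∑ k, C θ i k * ξ k) i ∂stdGaussianPi κ) θ := by
  refine (hasDerivAt_integral_of_dominated_loc_of_deriv_le
    (bound := fun ξ => p * β * (Fintype.card ι * (c * (1 + Fintype.card ι))) *
      Real.exp ((1 + β * c) * ∑ k, |ξ k|))
    (F' := fun θ ξ => p * β * ∑ i, (∑ k, C' θ i k * ξ k) *
        expSumGrad p β (fun i => ∑ k, C θ i k * ξ k) i)
    (s := Set.univ) Filter.univ_mem
    (Filter.Eventually.of_forall fun θ =>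
      (integrable_expSum_rpow hβ hp0 hp (C θ)).aestronglyMeasurable)
    (integrable_expSum_rpow hβ hp0 hp (C θ)) ?_ ?_
    ((integrable_exp_mul_sum_abs _).const_mul _) ?_).2
  · refine Continuous.aestronglyMeasurable (continuous_const.mul (continuous_finsetSum _
      fun i _ => .mul (by fun_prop) ((continuous_expSumGrad i).comp (by fun_prop))))
  · refine Filter.Eventually.of_forall fun ξ θ _ => ?_
    rw [Real.norm_eq_abs, abs_mul, abs_of_nonneg (mul_nonneg hp0 hβ), mul_assoc (p * β)]
    refine mul_le_mul_of_nonneg_left ((Finset.abs_sum_le_sum_abs _ _).trans ?_)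
      (mul_nonneg hp0 hβ)
    rw [mul_assoc, ← nsmul_eq_mul, ← Finset.card_univ]
    refine Finset.sum_le_card_nsmul _ _ _ fun i _ => ?_
    have h1 : |∑ k, C' θ i k * ξ k| ≤ c * Real.exp (∑ k, |ξ k|) := by
      calc |∑ k, C' θ i k * ξ k| ≤ ∑ k, c * |ξ k| :=
            (Finset.abs_sum_le_sum_abs _ _).trans (Finset.sum_le_sum fun k _ => by
              rw [abs_mul]; exact mul_le_mul_of_nonneg_right (hC' θ i k) (abs_nonneg _))
        _ = c * ∑ k, |ξ k| := by rw [Finset.mul_sum]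
        _ ≤ _ := mul_le_mul_of_nonneg_left
            ((le_add_of_nonneg_right zero_le_one).trans (Real.add_one_le_exp _)) hc0
    rw [abs_mul, abs_of_nonneg (expSumGrad_nonneg _ _), one_add_mul (β * c), Real.exp_add,
      mul_mul_mul_comm c]
    exact mul_le_mul h1
      ((expSumGrad_le _ _).trans (expSum_rpow_le hβ hp0 hp (hC θ) ξ))
      (expSumGrad_nonneg _ _) (by positivity)
  · exact Filter.Eventually.of_forall fun ξ θ _ => hasDerivAt_expSum_rpow fun i =>
      HasDerivAt.fun_sum fun k _ => (hd θ i k).mul_const _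

theorem integral_sum_mul_expSumGrad [DecidableEq ι] (hβ : 0 ≤ β) (hp0 : 0 ≤ p) (hp : p ≤ 1)
    (C C' : ι → κ → ℝ) :
    ∫ ξ, p * β * ∑ i, (∑ k, C' i k * ξ k) * expSumGrad p β (fun i => ∑ k, C i k * ξ k) i
        ∂stdGaussianPi κ =
      p * β * ∑ i, ∑ j, (∑ k, C' i k * C j k) *
        ∫ ξ, expSumHess p β (fun i => ∑ k, C i k * ξ k) i j ∂stdGaussianPi κ := by
  have hi : ∀ i k, Integrable (fun ξ : κ → ℝ =>
      C' i k * (ξ k * expSumGrad p β (fun i => ∑ k, C i k * ξ k) i)) (stdGaussianPi κ) :=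
    fun i k => (integrable_coord_mul_expSumGrad hβ hp0 hp C i k).const_mul _
  rw [integral_const_mul]
  have h : ∀ ξ : κ → ℝ, ∑ i, (∑ k, C' i k * ξ k) *
      expSumGrad p β (fun i => ∑ k, C i k * ξ k) i =
      ∑ i, ∑ k, C' i k * (ξ k * expSumGrad p β (fun i => ∑ k, C i k * ξ k) i) := by
    intro ξ
    simp only [Finset.sum_mul, mul_assoc]
  simp only [h]
  rw [integral_finsetSum _ fun i _ => integrable_finsetSum _ fun k _ => hi i k]
  congr 1
  refine Finset.sum_congr rfl fun i _ => ?_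
  rw [integral_finsetSum _ fun k _ => hi i k]
  simp only [integral_const_mul, integral_coord_mul_expSumGrad hβ hp0 hp, Finset.mul_sum,
    Finset.sum_mul, mul_assoc]
  exact Finset.sum_comm

/-- **Kahane's Gaussian comparison inequality** for the functional `(∑ i, exp (β x i)) ^ p`, with
`0 ≤ p ≤ 1`. The two Gaussian vectors `A ξ` and `B ξ` have the same variances, the covariances of
`A ξ` dominate those of `B ξ`, and the two are independent of each other. The expectation is
nondecreasing along the path `cos θ • A ξ + sin θ • B ξ`: by Stein's identity its derivative is a
sum of products of a covariance difference and an expected mixed second derivative, both of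
which are nonpositive. -/
theorem integral_expSum_rpow_le_of_covariance_le (hβ : 0 ≤ β) (hp0 : 0 ≤ p) (hp : p ≤ 1)
    (A B : ι → κ → ℝ) (hAB : ∀ i j, ∑ k, A i k * B j k = 0)
    (hdiag : ∀ i, ∑ k, A i k * A i k = ∑ k, B i k * B i k)
    (hoff : ∀ i j, ∑ k, B i k * B j k ≤ ∑ k, A i k * A j k) :
    ∫ ξ, expSum β (fun i => ∑ k, A i k * ξ k) ^ p ∂stdGaussianPi κ ≤
      ∫ ξ, expSum β (fun i => ∑ k, B i k * ξ k) ^ p ∂stdGaussianPi κ := by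
  classical
  set C : ℝ → ι → κ → ℝ := fun θ i k => Real.cos θ * A i k + Real.sin θ * B i k with hC
  set C' : ℝ → ι → κ → ℝ := fun θ i k => -Real.sin θ * A i k + Real.cos θ * B i k with hC'
  set c : ℝ := ∑ i, ∑ k, |A i k| + ∑ i, ∑ k, |B i k| with hc
  have hcs : ∀ a b : ℝ, |a| ≤ 1 → |b| ≤ 1 → ∀ i k, |a * A i k + b * B i k| ≤ c := by
    intro a b ha hb i k
    refine (abs_add_le _ _).trans (add_le_add ?_ ?_) <;> rw [abs_mul]
    · exact (mul_le_of_le_one_left (abs_nonneg _) ha).trans (abs_entry_le_sum A i k)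
    · exact (mul_le_of_le_one_left (abs_nonneg _) hb).trans (abs_entry_le_sum B i k)
  have hCc : ∀ θ i k, |C θ i k| ≤ c := fun θ =>
    hcs _ _ (Real.abs_cos_le_one θ) (Real.abs_sin_le_one θ)
  have hC'c : ∀ θ i k, |C' θ i k| ≤ c := fun θ =>
    hcs _ _ (by simpa using Real.abs_sin_le_one θ) (Real.abs_cos_le_one θ)
  have hc0 : 0 ≤ c := by positivity
  have hderiv := hasDerivAt_integral_expSum_rpow hβ hp0 hp hc0 hCc hC'c fun θ i k =>
    ((Real.hasDerivAt_cos θ).mul_const (A i k)).add ((Real.hasDerivAt_sin θ).mul_const (B i k))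
  have hcov : ∀ θ i j, ∑ k, C' θ i k * C θ j k = Real.sin θ * Real.cos θ *
      (∑ k, B i k * B j k - ∑ k, A i k * A j k) := by
    intro θ i j
    have h1 := hAB i j
    have h2 := hAB j i
    have : ∀ k, C' θ i k * C θ j k = Real.sin θ * Real.cos θ * (B i k * B j k - A i k * A j k) -
        Real.sin θ ^ 2 * (A i k * B j k) + Real.cos θ ^ 2 * (A j k * B i k) := by
      intro k; simp only [hC, hC']; ring
    simp_rw [this, Finset.sum_add_distrib, Finset.sum_sub_distrib, ← Finset.mul_sum, h1, h2,
      Finset.sum_sub_distrib]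
    ring
  have hmono : MonotoneOn
      (fun θ => ∫ ξ, expSum β (fun i => ∑ k, C θ i k * ξ k) ^ p ∂stdGaussianPi κ)
      (Set.Icc 0 (Real.pi / 2)) := by
    refine monotoneOn_of_deriv_nonneg (convex_Icc _ _)
      (fun θ _ => (hderiv θ).continuousAt.continuousWithinAt)
      (fun θ _ => (hderiv θ).differentiableAt.differentiableWithinAt) fun θ hθ => ?_
    rw [interior_Icc] at hθ
    have hs : 0 ≤ Real.sin θ * Real.cos θ :=
      mul_nonneg (Real.sin_nonneg_of_nonneg_of_le_pi hθ.1.le (by linarith [hθ.2, Real.pi_pos]))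
        (Real.cos_nonneg_of_neg_pi_div_two_le_of_le (by linarith [hθ.1, Real.pi_pos]) hθ.2.le)
    rw [(hderiv θ).deriv, integral_sum_mul_expSumGrad hβ hp0 hp]
    refine mul_nonneg (mul_nonneg hp0 hβ) (Finset.sum_nonneg fun i _ => Finset.sum_nonneg
      fun j _ => ?_)
    rw [hcov]
    by_cases hij : i = j
    · subst hij; simp [hdiag]
    · exact mul_nonneg_of_nonpos_of_nonpos
        (mul_nonpos_of_nonneg_of_nonpos hs (sub_nonpos.2 (hoff i j)))
        (integral_nonpos fun ξ => expSumHess_nonpos_of_ne hβ hp _ hij)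
  have := hmono ⟨le_rfl, by positivity⟩ ⟨by positivity, le_rfl⟩
    (by positivity : (0 : ℝ) ≤ Real.pi / 2)
  simpa [hC] using this

end Comparison

/-! ### Exponential moments of the norm of a Gaussian vector -/

theorem integrable_exp_mul_sq_gaussianReal {a : ℝ} (ha : a < 1 / 2) :
    Integrable (fun s : ℝ => Real.exp (a * s ^ 2)) (gaussianReal 0 1) := by
  rw [gaussianReal_of_var_ne_zero 0 one_ne_zero,
    integrable_withDensity_iff (measurable_gaussianPDF _ _) (by simp [gaussianPDF])]
  refine ((integrable_exp_neg_mul_sq (b := 1 / 2 - a) (by linarith)).const_mul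
    (√(2 * Real.pi))⁻¹).congr (Filter.Eventually.of_forall fun s => ?_)
  simp only [toReal_gaussianPDF, gaussianPDFReal, NNReal.coe_one, mul_one, sub_zero]
  rw [mul_left_comm, ← Real.exp_add]
  ring_nf

theorem integral_exp_mul_sq_gaussianReal {a : ℝ} (ha : a < 1 / 2) :
    ∫ s, Real.exp (a * s ^ 2) ∂gaussianReal 0 1 = (1 - 2 * a) ^ (-(1 / 2) : ℝ) := by
  rw [integral_gaussianReal_eq_integral_smul one_ne_zero]
  have h : ∀ s : ℝ, gaussianPDFReal 0 1 s • Real.exp (a * s ^ 2) =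
      (√(2 * Real.pi))⁻¹ * Real.exp (-(1 / 2 - a) * s ^ 2) := by
    intro s
    simp only [smul_eq_mul, gaussianPDFReal, NNReal.coe_one, mul_one, sub_zero]
    rw [mul_assoc, ← Real.exp_add]
    ring_nf
  simp_rw [h]
  have h1 : 0 < 1 - 2 * a := by linarith
  rw [integral_const_mul, integral_gaussian, Real.rpow_neg h1.le, ← Real.sqrt_eq_rpow,
    ← Real.sqrt_inv, ← Real.sqrt_inv, ← Real.sqrt_mul (by positivity)]
  congr 1
  have := Real.pi_ne_zero
  field_simp

theorem integrable_exp_mul_sum_sq {κ : Type*} [Fintype κ] {a : ℝ} (ha : a < 1 / 2) :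
    Integrable (fun ξ : κ → ℝ => Real.exp (a * ∑ k, ξ k ^ 2)) (stdGaussianPi κ) := by
  simp_rw [Finset.mul_sum, Real.exp_sum]
  exact Integrable.fintype_prod (f := fun _ s => Real.exp (a * s ^ 2))
    fun _ => integrable_exp_mul_sq_gaussianReal ha

/-- The moment generating function of the chi-square law. -/
theorem integral_exp_mul_sum_sq {κ : Type*} [Fintype κ] {a : ℝ} (ha : a < 1 / 2) :
    ∫ ξ : κ → ℝ, Real.exp (a * ∑ k, ξ k ^ 2) ∂stdGaussianPi κ =
      (1 - 2 * a) ^ (-(Fintype.card κ / 2) : ℝ) := by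
  simp_rw [Finset.mul_sum, Real.exp_sum]
  rw [integral_fintype_prod_eq_prod (fun _ s => Real.exp (a * s ^ 2))]
  simp only [integral_exp_mul_sq_gaussianReal ha, Finset.prod_const, Finset.card_univ]
  rw [← Real.rpow_natCast, ← Real.rpow_mul (by linarith)]
  congr 1
  ring

/-- The upper tail of the chi-square law, by the Chernoff bound with parameter
`ε / (2 (1 + ε))`. -/
theorem measureReal_card_mul_le_sum_sq {κ : Type*} [Fintype κ] {ε : ℝ} (hε : 0 < ε) :
    (stdGaussianPi κ).real {ξ | Fintype.card κ * (1 + ε) ≤ ∑ k, ξ k ^ 2} ≤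
      ((1 + ε) * Real.exp (-ε)) ^ ((Fintype.card κ : ℝ) / 2) := by
  set a : ℝ := ε / (2 * (1 + ε)) with ha_def
  have ha : a < 1 / 2 := by
    rw [ha_def, div_lt_div_iff₀ (by positivity) (by positivity)]; linarith
  have ha0 : 0 < a := by positivity
  have hmarkov := mul_meas_ge_le_integral_of_nonneg
    (Filter.Eventually.of_forall fun ξ : κ → ℝ => (Real.exp_pos (a * ∑ k, ξ k ^ 2)).le)
    (integrable_exp_mul_sum_sq ha) (Real.exp (a * (Fintype.card κ * (1 + ε))))
  rw [integral_exp_mul_sum_sq ha] at hmarkov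
  simp only [Real.exp_le_exp, mul_le_mul_iff_right₀ ha0] at hmarkov
  rw [mul_comm, ← le_div_iff₀ (Real.exp_pos _)] at hmarkov
  refine hmarkov.trans_eq ?_
  have h1 : 1 - 2 * a = (1 + ε)⁻¹ := by rw [ha_def]; field_simp; ring
  rw [h1, Real.inv_rpow (by positivity), Real.rpow_neg (by positivity), inv_inv,
    Real.mul_rpow (by positivity) (Real.exp_pos _).le, ← Real.exp_mul, div_eq_mul_inv,
    ← Real.exp_neg]
  congr 2
  rw [ha_def]; field_simp

theorem mul_sqrt_le_add_mul {l c : ℝ} (hl : 0 ≤ l) (hc : 0 < c) {q : ℝ} (hq : 0 ≤ q) :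
    l * √q ≤ l * c / 2 + l / (2 * c) * q := by
  have h : 0 ≤ l / (2 * c) * (√q - c) ^ 2 := by positivity
  have h2 : l / (2 * c) * (√q - c) ^ 2 = l * c / 2 + l / (2 * c) * q - l * √q := by
    rw [sub_sq, Real.sq_sqrt hq]; field_simp; ring
  linarith

theorem div_two_mul_add_lt_half {m l : ℝ} (hm : 0 < m) (hl : 0 ≤ l) :
    l / (2 * (m + l)) < 1 / 2 := by
  rw [div_lt_div_iff₀ (by positivity) (by positivity)]; linarith

theorem integrable_exp_mul_sqrt_sum_sq {κ : Type*} [Fintype κ] {l : ℝ} (hl : 0 ≤ l) :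
    Integrable (fun ξ : κ → ℝ => Real.exp (l * √(∑ k, ξ k ^ 2))) (stdGaussianPi κ) := by
  refine ((integrable_exp_mul_sum_sq (div_two_mul_add_lt_half one_pos hl)).const_mul
    (Real.exp (l * (1 + l) / 2))).mono'
    (Continuous.aestronglyMeasurable (by fun_prop)) (Filter.Eventually.of_forall fun ξ => ?_)
  rw [Real.norm_eq_abs, abs_of_pos (Real.exp_pos _), ← Real.exp_add, Real.exp_le_exp]
  exact mul_sqrt_le_add_mul hl (by positivity) (Finset.sum_nonneg fun _ _ => sq_nonneg _)

/-- Sub-Gaussian bound, with the sharp constant, for the norm of a standard Gaussian vector. It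
follows from the chi-square moment generating function and
`√q ≤ c / 2 + q / (2 c)`, for `c = √d + l`. -/
theorem integral_exp_mul_sqrt_sum_sq_le {κ : Type*} [Fintype κ] [Nonempty κ] {l : ℝ}
    (hl : 0 ≤ l) :
    ∫ ξ : κ → ℝ, Real.exp (l * √(∑ k, ξ k ^ 2)) ∂stdGaussianPi κ ≤
      Real.exp (l * √(Fintype.card κ : ℝ) + l ^ 2 / 2) := by
  set d : ℝ := (Fintype.card κ : ℝ) with hd
  have hd0 : 0 < d := by rw [hd]; exact_mod_cast Fintype.card_pos
  set r := √d with hr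
  have hr0 : 0 < r := Real.sqrt_pos.2 hd0
  have hrd : r ^ 2 = d := Real.sq_sqrt hd0.le
  have ha := div_two_mul_add_lt_half hr0 hl
  calc ∫ ξ : κ → ℝ, Real.exp (l * √(∑ k, ξ k ^ 2)) ∂stdGaussianPi κ
      ≤ ∫ ξ : κ → ℝ, Real.exp (l * (r + l) / 2) *
          Real.exp (l / (2 * (r + l)) * ∑ k, ξ k ^ 2) ∂stdGaussianPi κ := by
        refine integral_mono (integrable_exp_mul_sqrt_sum_sq hl)
          ((integrable_exp_mul_sum_sq ha).const_mul _) fun ξ => ?_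
        simp only
        rw [← Real.exp_add, Real.exp_le_exp]
        exact mul_sqrt_le_add_mul hl (by positivity) (Finset.sum_nonneg fun _ _ => sq_nonneg _)
    _ = Real.exp (l * (r + l) / 2) * (1 + l / r) ^ (d / 2) := by
        rw [integral_const_mul, integral_exp_mul_sum_sq ha, ← hd]
        have h1 : 1 - 2 * (l / (2 * (r + l))) = r / (r + l) := by field_simp; ring
        rw [h1, Real.rpow_neg (by positivity), ← Real.inv_rpow (by positivity), inv_div, add_div,
          div_self hr0.ne']
    _ ≤ Real.exp (l * (r + l) / 2) * Real.exp (l / r) ^ (d / 2) := by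
        gcongr
        linarith [Real.add_one_le_exp (l / r)]
    _ = Real.exp (l * r + l ^ 2 / 2) := by
        rw [← Real.exp_mul, ← Real.exp_add, ← hrd]
        congr 1
        field_simp
        ring

theorem measurePreserving_sum_stdGaussianPi (κ κ' : Type*) [Fintype κ] [Fintype κ'] :
    MeasurePreserving (MeasurableEquiv.sumPiEquivProdPi fun _ : κ ⊕ κ' => ℝ)
      (stdGaussianPi (κ ⊕ κ')) ((stdGaussianPi κ).prod (stdGaussianPi κ')) :=
  measurePreserving_sumPiEquivProdPi fun _ => gaussianReal 0 1

theorem integral_mul_stdGaussianPi_sum {κ κ' : Type*} [Fintype κ] [Fintype κ']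
    (f : (κ → ℝ) → ℝ) (g : (κ' → ℝ) → ℝ) :
    ∫ ξ, f (fun k => ξ (.inl k)) * g (fun k => ξ (.inr k)) ∂stdGaussianPi (κ ⊕ κ') =
      (∫ ξ, f ξ ∂stdGaussianPi κ) * ∫ ξ, g ξ ∂stdGaussianPi κ' := by
  rw [← integral_prod_mul, ← (measurePreserving_sum_stdGaussianPi κ κ').integral_comp']
  rfl

theorem integrable_mul_stdGaussianPi_sum {κ κ' : Type*} [Fintype κ] [Fintype κ']
    {f : (κ → ℝ) → ℝ} {g : (κ' → ℝ) → ℝ} (hf : Integrable f (stdGaussianPi κ))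
    (hg : Integrable g (stdGaussianPi κ')) :
    Integrable (fun ξ => f (fun k => ξ (.inl k)) * g (fun k => ξ (.inr k)))
      (stdGaussianPi (κ ⊕ κ')) :=
  (measurePreserving_sum_stdGaussianPi κ κ').integrable_comp_of_integrable (hf.mul_prod hg)

/-! ### The Davidson–Szarek inequality -/

theorem exists_finite_net_sphere (E : Type*) [NormedAddCommGroup E] [NormedSpace ℝ E]
    [FiniteDimensional ℝ E] {δ : ℝ} (hδ : 0 < δ) :
    ∃ T : Finset E, (∀ u ∈ T, ‖u‖ = 1) ∧ ∀ u : E, ‖u‖ = 1 → ∃ v ∈ T, ‖u - v‖ ≤ δ := by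
  obtain ⟨t, ht, hfin, hcov⟩ := (isCompact_sphere (0 : E) 1).finite_cover_balls hδ
  lift t to Finset E using hfin
  refine ⟨t, fun u hu => by simpa using ht hu, fun u hu => ?_⟩
  have := hcov (show u ∈ Metric.sphere (0 : E) 1 by simpa using hu)
  simp only [Set.mem_iUnion, Metric.mem_ball, exists_prop, dist_eq_norm] at this
  obtain ⟨v, hv, hlt⟩ := this
  exact ⟨v, hv, hlt.le⟩

/-- On `δ`-nets of the unit spheres the bilinear form of an operator reaches its norm up to a
relative error of `3 δ`. -/
theorem exists_mem_net_lt_inner {E F : Type*} [NormedAddCommGroup E] [InnerProductSpace ℝ E]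
    [NormedAddCommGroup F] [InnerProductSpace ℝ F] {δ : ℝ} (hδ : 0 < δ) (hδ' : 3 * δ ≤ 1)
    {T : Finset F} {T' : Finset E} (hT1 : ∀ u ∈ T, ‖u‖ = 1)
    (hT : ∀ u : F, ‖u‖ = 1 → ∃ v ∈ T, ‖u - v‖ ≤ δ)
    (hT' : ∀ u : E, ‖u‖ = 1 → ∃ v ∈ T', ‖u - v‖ ≤ δ) (L : E →L[ℝ] F) (hL : 0 < ‖L‖) :
    ∃ u ∈ T, ∃ v ∈ T', (1 - 3 * δ) * ‖L‖ < inner ℝ u (L v) := by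
  by_contra! hcon
  have hle : ‖L‖ ≤ (1 - δ) * ‖L‖ := by
    refine L.opNorm_le_of_unit_norm (by nlinarith) fun v hv => ?_
    rcases eq_or_ne (L v) 0 with h0 | h0
    · rw [h0, norm_zero]; nlinarith
    have hn : 0 < ‖L v‖ := norm_pos_iff.2 h0
    set u : F := ‖L v‖⁻¹ • L v with hu
    have hu1 : ‖u‖ = 1 := by rw [hu, norm_smul, norm_inv, norm_norm, inv_mul_cancel₀ hn.ne']
    obtain ⟨u', hu', huu⟩ := hT u hu1
    obtain ⟨v', hv', hvv⟩ := hT' v hv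
    have h1 : ‖L v‖ = inner ℝ u (L v) := by
      rw [hu, real_inner_smul_left, real_inner_self_eq_norm_sq, sq, inv_mul_cancel_left₀ hn.ne']
    have h2 : inner ℝ u (L v) =
        inner ℝ u' (L v') + inner ℝ (u - u') (L v) + inner ℝ u' (L (v - v')) := by
      rw [map_sub, inner_sub_left, inner_sub_right]; ring
    have h3 : inner ℝ (u - u') (L v) ≤ δ * ‖L‖ :=
      (real_inner_le_norm _ _).trans (mul_le_mul huu
        ((L.le_opNorm v).trans (by rw [hv, mul_one])) (norm_nonneg _) hδ.le)
    have h4 : inner ℝ u' (L (v - v')) ≤ δ * ‖L‖ := by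
      refine (real_inner_le_norm _ _).trans ?_
      rw [hT1 u' hu', one_mul, mul_comm]
      exact (L.le_opNorm _).trans (mul_le_mul_of_nonneg_left hvv (norm_nonneg _))
    linarith [hcon u' hu' v' hv']
  nlinarith

section DavidsonSzarek

variable {m n : Type*} [Fintype m] [Fintype n]

/-- The bilinear form `uᵀ ξ v` of a matrix `ξ`. -/
noncomputable def bilinearValue (ξ : m × n → ℝ) (u : EuclideanSpace ℝ m)
    (v : EuclideanSpace ℝ n) : ℝ := ∑ k, u k.1 * v k.2 * ξ k

/-- The Gaussian comparison of `uᵀ ξ v + z` with `⟪u, g⟫ + ⟪v, h⟫`, over finite sets of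
unit vectors: both processes have variance `2`, and the covariances differ by
`(1 - ⟪u, u'⟫) (1 - ⟪v, v'⟫)`. The additional standard Gaussian variable `z` contributes
the factor `exp (l ^ 2 / 2)`. -/
theorem integral_expSum_bilinearValue_le [Nonempty m] [Nonempty n]
    {T : Finset (EuclideanSpace ℝ m)} {T' : Finset (EuclideanSpace ℝ n)}
    (hT : ∀ u ∈ T, ‖u‖ = 1) (hT' : ∀ v ∈ T', ‖v‖ = 1) [Nonempty (T × T')] {l p : ℝ} (hl : 0 ≤ l)
    (hp0 : 0 < p) (hp : p ≤ 1) :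
    ∫ ξ, expSum (l / p) (fun i : T × T' => bilinearValue ξ i.1 i.2) ^ p ∂stdGaussianPi (m × n) ≤
      (Fintype.card (T × T') : ℝ) ^ p *
        Real.exp (l * (√(Fintype.card m : ℝ) + √(Fintype.card n : ℝ)) + l ^ 2 / 2) := by
  have hβ : 0 ≤ l / p := by positivity
  let A : T × T' → ((m × n) ⊕ Unit) ⊕ (m ⊕ n) → ℝ := fun i =>
    Sum.elim (Sum.elim (fun k => i.1.1 k.1 * i.2.1 k.2) fun _ => 1) fun _ => 0
  let B : T × T' → ((m × n) ⊕ Unit) ⊕ (m ⊕ n) → ℝ := fun i =>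
    Sum.elim (fun _ => 0) (Sum.elim (fun k => i.1.1 k) fun k => i.2.1 k)
  have hcov : ∀ i j : T × T', ∑ k, A i k * A j k =
      inner ℝ i.1.1 j.1.1 * inner ℝ i.2.1 j.2.1 + 1 := by
    intro i j
    simp only [A, Fintype.sum_sum_type, Sum.elim_inl, Sum.elim_inr, PiLp.inner_apply,
      RCLike.inner_apply, conj_trivial, Finset.sum_mul_sum, Fintype.sum_prod_type]
    simp only [mul_one, Finset.sum_const, Finset.card_univ, Fintype.card_unit, one_smul, mul_zero,
      smul_zero, add_zero]
    congr 1
    exact Finset.sum_congr rfl fun _ _ => Finset.sum_congr rfl fun _ _ => by ring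
  have hcov' : ∀ i j : T × T', ∑ k, B i k * B j k =
      inner ℝ i.1.1 j.1.1 + inner ℝ i.2.1 j.2.1 := by
    intro i j
    simp [B, Fintype.sum_sum_type, PiLp.inner_apply, mul_comm]
  have hone : ∀ u : T, inner ℝ u.1 u.1 = (1 : ℝ) := fun u => by
    rw [real_inner_self_eq_norm_sq, hT _ u.2, one_pow]
  have hone' : ∀ u : T', inner ℝ u.1 u.1 = (1 : ℝ) := fun u => by
    rw [real_inner_self_eq_norm_sq, hT' _ u.2, one_pow]
  have key := integral_expSum_rpow_le_of_covariance_le hβ hp0.le hp A B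
    (fun i j => by simp [A, B, Fintype.sum_sum_type])
    (fun i => by rw [hcov, hcov', hone, hone']; norm_num)
    (fun i j => by
      have h1 : inner ℝ i.1.1 j.1.1 ≤ (1 : ℝ) := by
        simpa [hT _ i.1.2, hT _ j.1.2] using real_inner_le_norm i.1.1 j.1.1
      have h2 : inner ℝ i.2.1 j.2.1 ≤ (1 : ℝ) := by
        simpa [hT' _ i.2.2, hT' _ j.2.2] using real_inner_le_norm i.2.1 j.2.1
      rw [hcov, hcov']
      nlinarith [mul_nonneg (sub_nonneg.2 h1) (sub_nonneg.2 h2)])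
  have hlp : l / p * p = l := div_mul_cancel₀ l hp0.ne'
  have hleft : ∫ ξ, expSum (l / p) (fun i => ∑ k, A i k * ξ k) ^ p
      ∂stdGaussianPi (((m × n) ⊕ Unit) ⊕ (m ⊕ n)) =
      (∫ ξ, expSum (l / p) (fun i : T × T' => bilinearValue ξ i.1 i.2) ^ p
        ∂stdGaussianPi (m × n)) * Real.exp (l ^ 2 / 2) := by
    have hz : ∫ ξ : Unit → ℝ, Real.exp (l * ξ ()) ∂stdGaussianPi Unit = Real.exp (l ^ 2 / 2) := by
      have := integral_fintype_prod_eq_prod (μ := fun _ : Unit => gaussianReal 0 1)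
        (fun _ s => Real.exp (l * s))
      simp only [Finset.univ_unique, Finset.prod_singleton] at this
      have h2 := congrFun (mgf_fun_id_gaussianReal (μ := 0) (v := 1)) l
      simp only [mgf, zero_mul, zero_add, NNReal.coe_one, one_mul] at h2
      exact this.trans h2
    have h1 := integral_mul_stdGaussianPi_sum (κ := (m × n) ⊕ Unit) (κ' := m ⊕ n)
      (fun ξ => expSum (l / p)
          (fun i : T × T' => bilinearValue (fun k => ξ (.inl k)) i.1 i.2) ^ p *
        Real.exp (l * ξ (.inr ()))) (fun _ => 1)
    have h2 := integral_mul_stdGaussianPi_sum (κ := m × n) (κ' := Unit)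
      (fun ξ => expSum (l / p) (fun i : T × T' => bilinearValue ξ i.1 i.2) ^ p)
      (fun ξ => Real.exp (l * ξ ()))
    rw [hz] at h2
    rw [h2] at h1
    simp only [mul_one, integral_const, probReal_univ, smul_eq_mul] at h1
    rw [← h1]
    refine integral_congr_ae (Filter.Eventually.of_forall fun ξ => ?_)
    have hpos := expSum_pos (β := l / p)
      (fun i : T × T' => bilinearValue (fun k => ξ (.inl (.inl k))) i.1 i.2)
    have hexp : Real.exp (l * ξ (.inl (.inr ()))) =
        Real.exp (l / p * ξ (.inl (.inr ()))) ^ p := by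
      rw [← Real.exp_mul, mul_right_comm, hlp]
    simp only
    rw [hexp, ← Real.mul_rpow hpos.le (Real.exp_pos _).le, expSum, expSum, Finset.sum_mul]
    congr 1
    refine Finset.sum_congr rfl fun i _ => ?_
    rw [← Real.exp_add, ← mul_add]
    simp [A, bilinearValue, Fintype.sum_sum_type]
  have hright : ∫ ξ, expSum (l / p) (fun i => ∑ k, B i k * ξ k) ^ p
      ∂stdGaussianPi (((m × n) ⊕ Unit) ⊕ (m ⊕ n)) ≤
      (Fintype.card (T × T') : ℝ) ^ p *
        (Real.exp (l * √(Fintype.card m : ℝ) + l ^ 2 / 2) *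
          Real.exp (l * √(Fintype.card n : ℝ) + l ^ 2 / 2)) := by
    have h1 := integral_mul_stdGaussianPi_sum (κ := (m × n) ⊕ Unit) (κ' := m ⊕ n)
      (fun _ => 1) (fun ξ => Real.exp (l * √(∑ k, ξ (.inl k) ^ 2)) *
        Real.exp (l * √(∑ k, ξ (.inr k) ^ 2)))
    have h2 := integral_mul_stdGaussianPi_sum (κ := m) (κ' := n)
      (fun ξ => Real.exp (l * √(∑ k, ξ k ^ 2))) (fun ξ => Real.exp (l * √(∑ k, ξ k ^ 2)))
    rw [h2] at h1
    simp only [one_mul, integral_const, probReal_univ, smul_eq_mul] at h1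
    have hint := integrable_mul_stdGaussianPi_sum (κ := (m × n) ⊕ Unit)
      (integrable_const (1 : ℝ)) (integrable_mul_stdGaussianPi_sum
        (integrable_exp_mul_sqrt_sum_sq (κ := m) hl) (integrable_exp_mul_sqrt_sum_sq (κ := n) hl))
    simp only [one_mul] at hint
    calc _ ≤ ∫ ξ : ((m × n) ⊕ Unit) ⊕ (m ⊕ n) → ℝ, (Fintype.card (T × T') : ℝ) ^ p *
          (Real.exp (l * √(∑ k, ξ (.inr (.inl k)) ^ 2)) *
            Real.exp (l * √(∑ k, ξ (.inr (.inr k)) ^ 2)))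
            ∂stdGaussianPi (((m × n) ⊕ Unit) ⊕ (m ⊕ n)) := by
          refine integral_mono (integrable_expSum_rpow hβ hp0.le hp B) (hint.const_mul _)
            fun ξ => ?_
          have hle : expSum (l / p) (fun i => ∑ k, B i k * ξ k) ≤ Fintype.card (T × T') *
              Real.exp (l / p * (√(∑ k, ξ (.inr (.inl k)) ^ 2) +
                √(∑ k, ξ (.inr (.inr k)) ^ 2))) := by
            rw [expSum, ← nsmul_eq_mul, ← Finset.card_univ]
            refine Finset.sum_le_card_nsmul _ _ _ fun i _ => Real.exp_le_exp.2
              (mul_le_mul_of_nonneg_left ?_ hβ)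
            simp only [B, Fintype.sum_sum_type, Sum.elim_inl, Sum.elim_inr, zero_mul,
              Finset.sum_const_zero, zero_add]
            have e1 := hT _ i.1.2
            have e2 := hT' _ i.2.2
            rw [EuclideanSpace.norm_eq] at e1 e2
            simp only [Real.norm_eq_abs, sq_abs] at e1 e2
            refine add_le_add ?_ ?_
            · simpa [e1] using Real.sum_mul_le_sqrt_mul_sqrt Finset.univ
                (fun k => i.1.1 k) fun k => ξ (.inr (.inl k))
            · simpa [e2] using Real.sum_mul_le_sqrt_mul_sqrt Finset.univ
                (fun k => i.2.1 k) fun k => ξ (.inr (.inr k))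
          refine (Real.rpow_le_rpow (expSum_pos _).le hle hp0.le).trans_eq ?_
          rw [Real.mul_rpow (by positivity) (Real.exp_pos _).le, ← Real.exp_mul, ← Real.exp_add,
            mul_right_comm, hlp, mul_add]
      _ ≤ _ := by
          rw [integral_const_mul, h1]
          gcongr
          · exact integral_exp_mul_sqrt_sum_sq_le hl
          · exact integral_exp_mul_sqrt_sum_sq_le hl
  rw [hleft, ← le_div_iff₀ (Real.exp_pos _)] at key
  refine (key.trans (div_le_div_of_nonneg_right hright (Real.exp_pos _).le)).trans_eq ?_
  rw [mul_div_assoc, ← Real.exp_add, ← Real.exp_sub]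
  ring_nf

theorem inner_toEuclideanLin_eq_bilinearValue [DecidableEq n] (ξ : m × n → ℝ)
    (u : EuclideanSpace ℝ m) (v : EuclideanSpace ℝ n) :
    inner ℝ u (Matrix.toEuclideanLin (Matrix.of fun i j => ξ (i, j)) v) =
      bilinearValue ξ u v := by
  simp only [bilinearValue, PiLp.inner_apply, RCLike.inner_apply, conj_trivial,
    Fintype.sum_prod_type, Matrix.toLpLin_apply, Matrix.mulVec, dotProduct, Matrix.of_apply,
    Finset.sum_mul]
  exact Finset.sum_congr rfl fun _ _ => Finset.sum_congr rfl fun _ _ => by ring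

theorem integrable_expSum_bilinearValue (T : Finset (EuclideanSpace ℝ m))
    (T' : Finset (EuclideanSpace ℝ n)) [Nonempty (T × T')] {β p : ℝ} (hβ : 0 ≤ β) (hp0 : 0 ≤ p)
    (hp : p ≤ 1) :
    Integrable (fun ξ : m × n → ℝ =>
      expSum β (fun i : T × T' => bilinearValue ξ i.1 i.2) ^ p) (stdGaussianPi (m × n)) := by
  let C : T × T' → m × n → ℝ := fun i k => i.1.1 k.1 * i.2.1 k.2
  exact integrable_expSum_rpow hβ hp0 hp C

end DavidsonSzarek

/-- The **Davidson–Szarek inequality** for the largest singular value of a Gaussian matrix. -/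
theorem measureReal_le_spectralNorm₂ {M w : ℕ} [Nonempty (Fin M)] [Nonempty (Fin w)] {τ : ℝ}
    (hτ : 0 < τ) :
    (stdGaussianPi (Fin M × Fin w)).real
        {ξ | √(M : ℝ) + √(w : ℝ) + τ ≤ spectralNorm₂ (Matrix.of fun i j => ξ (i, j))} ≤
      Real.exp (-(τ ^ 2 / 2)) := by
  set s : ℝ := √(M : ℝ) + √(w : ℝ) + τ with hs
  have hs0 : 0 < s := by positivity
  set E : Set (Fin M × Fin w → ℝ) := {ξ | s ≤ spectralNorm₂ (Matrix.of fun i j => ξ (i, j))}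
    with hE
  have hδ : ∀ δ : ℝ, 0 < δ → 3 * δ ≤ 1 → (stdGaussianPi (Fin M × Fin w)).real E ≤
      Real.exp (τ * (√(M : ℝ) + √(w : ℝ)) + τ ^ 2 / 2 - τ * ((1 - 3 * δ) * s)) := by
    intro δ hδ hδ'
    obtain ⟨T, hT1, hT⟩ := exists_finite_net_sphere (EuclideanSpace ℝ (Fin M)) hδ
    obtain ⟨T', hT1', hT'⟩ := exists_finite_net_sphere (EuclideanSpace ℝ (Fin w)) hδ
    have hne : Nonempty (T × T') := by
      obtain ⟨x, hx⟩ := exists_norm_eq (EuclideanSpace ℝ (Fin M)) zero_le_one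
      obtain ⟨y, hy⟩ := exists_norm_eq (EuclideanSpace ℝ (Fin w)) zero_le_one
      obtain ⟨u, hu, -⟩ := hT x hx
      obtain ⟨v, hv, -⟩ := hT' y hy
      exact ⟨⟨u, hu⟩, ⟨v, hv⟩⟩
    have hp : ∀ p ∈ Set.Ioc (0 : ℝ) 1, (stdGaussianPi (Fin M × Fin w)).real E ≤
        (Fintype.card (T × T') : ℝ) ^ p *
          Real.exp (τ * (√(M : ℝ) + √(w : ℝ)) + τ ^ 2 / 2 - τ * ((1 - 3 * δ) * s)) := by
      rintro p ⟨hp0, hp1⟩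
      have hβ : 0 ≤ τ / p := by positivity
      have hint := integrable_expSum_bilinearValue T T' hβ hp0.le hp1
      have hmarkov := mul_meas_ge_le_integral_of_nonneg
        (Filter.Eventually.of_forall fun ξ => Real.rpow_nonneg (expSum_pos _).le p) hint
        (Real.exp (τ * ((1 - 3 * δ) * s)))
      -- The power of the exponential sum dominates the exponential of each of its entries, in
      -- particular of the one at which the net nearly attains the norm.
      have hsub : E ⊆ {ξ | Real.exp (τ * ((1 - 3 * δ) * s)) ≤
          expSum (τ / p) (fun i : T × T' => bilinearValue ξ i.1 i.2) ^ p} := by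
        intro ξ hξ
        simp only [hE, Set.mem_ofPred_eq, spectralNorm₂] at hξ
        obtain ⟨u, hu, v, hv, huv⟩ := exists_mem_net_lt_inner hδ hδ' hT1 hT hT' _
          (hs0.trans_le hξ)
        rw [LinearMap.coe_toContinuousLinearMap', inner_toEuclideanLin_eq_bilinearValue] at huv
        calc Real.exp (τ * ((1 - 3 * δ) * s)) ≤ Real.exp (τ * bilinearValue ξ u v) := by
              refine Real.exp_le_exp.2 (mul_le_mul_of_nonneg_left (le_trans ?_ huv.le) hτ.le)
              exact mul_le_mul_of_nonneg_left hξ (by linarith)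
          _ = Real.exp (τ / p * bilinearValue ξ u v) ^ p := by
              rw [← Real.exp_mul, mul_right_comm, div_mul_cancel₀ _ hp0.ne']
          _ ≤ _ := Real.rpow_le_rpow (Real.exp_pos _).le
              (exp_le_expSum (fun i : T × T' => bilinearValue ξ i.1 i.2) (⟨u, hu⟩, ⟨v, hv⟩))
              hp0.le
      have h := (mul_le_mul_of_nonneg_left (measureReal_mono hsub) (Real.exp_pos _).le).trans
        (hmarkov.trans (integral_expSum_bilinearValue_le hT1 hT1' hτ.le hp0 hp1))
      rw [mul_comm, ← le_div_iff₀ (Real.exp_pos _), mul_div_assoc, ← Real.exp_sub] at h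
      simpa using h
    -- The nets depend on `δ` only, so that their cardinality disappears as `p → 0`.
    have hlim : Filter.Tendsto (fun p : ℝ => (Fintype.card (T × T') : ℝ) ^ p *
        Real.exp (τ * (√(M : ℝ) + √(w : ℝ)) + τ ^ 2 / 2 - τ * ((1 - 3 * δ) * s)))
        (nhdsWithin 0 (Set.Ioi 0)) (nhds ((Fintype.card (T × T') : ℝ) ^ (0 : ℝ) *
          Real.exp (τ * (√(M : ℝ) + √(w : ℝ)) + τ ^ 2 / 2 - τ * ((1 - 3 * δ) * s)))) :=
      ((Real.continuousAt_const_rpow (by exact_mod_cast Fintype.card_ne_zero)).tendsto.mono_left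
        nhdsWithin_le_nhds).mul_const _
    rw [Real.rpow_zero, one_mul] at hlim
    exact ge_of_tendsto hlim (Filter.eventually_of_mem (Ioc_mem_nhdsGT one_pos) hp)
  have hlim : Filter.Tendsto (fun δ : ℝ =>
      Real.exp (τ * (√(M : ℝ) + √(w : ℝ)) + τ ^ 2 / 2 - τ * ((1 - 3 * δ) * s)))
      (nhdsWithin 0 (Set.Ioi 0)) (nhds (Real.exp (-(τ ^ 2 / 2)))) := by
    have hc : Continuous fun δ : ℝ =>
        Real.exp (τ * (√(M : ℝ) + √(w : ℝ)) + τ ^ 2 / 2 - τ * ((1 - 3 * δ) * s)) := by fun_prop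
    convert (hc.tendsto 0).mono_left nhdsWithin_le_nhds using 3
    rw [hs]; ring
  refine ge_of_tendsto hlim (Filter.eventually_of_mem
    (Ioc_mem_nhdsGT (show (0 : ℝ) < 1 / 3 by norm_num)) fun δ h => hδ δ h.1 ?_)
  linarith [h.2]

/-! ### The history matrix -/

theorem sigmaOne_le_spectralNorm₂ {M w : ℕ} (A : Matrix (Fin M) (Fin w) ℝ) :
    sigmaOne A ≤ spectralNorm₂ A := by
  unfold sigmaOne spectralNorm₂
  set T := Matrix.toEuclideanLin A
  rcases Nat.eq_zero_or_pos (Module.finrank ℝ (EuclideanSpace ℝ (Fin w))) with h | h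
  · rw [T.singularValues_of_finrank_le h.le]
    exact norm_nonneg _
  obtain ⟨v, hv, hv0⟩ := (T.hasEigenvalue_adjoint_comp_self_sq_singularValues h).exists_hasEigenvector
  have hv1 : (LinearMap.adjoint T) (T v) = T.singularValues 0 ^ 2 • v := by
    simpa using Module.End.mem_eigenspace_iff.1 hv
  have h1 : ‖T v‖ ^ 2 = (T.singularValues 0 * ‖v‖) ^ 2 := by
    rw [← real_inner_self_eq_norm_sq, ← LinearMap.adjoint_inner_left, hv1, real_inner_smul_left,
      real_inner_self_eq_norm_sq, mul_pow]
  have h2 : ‖T v‖ = T.singularValues 0 * ‖v‖ :=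
    (sq_eq_sq₀ (norm_nonneg _) (mul_nonneg (T.singularValues_nonneg 0) (norm_nonneg _))).1 h1
  have h3 := (LinearMap.toContinuousLinearMap T).le_opNorm v
  rw [LinearMap.coe_toContinuousLinearMap', h2] at h3
  exact le_of_mul_le_mul_right h3 (norm_pos_iff.2 hv0)

theorem spectralNorm₂_sub_le {M w : ℕ} (A B : Matrix (Fin M) (Fin w) ℝ) :
    spectralNorm₂ (A - B) ≤ spectralNorm₂ A + spectralNorm₂ B := by
  unfold spectralNorm₂
  rw [map_sub, map_sub]
  exact norm_sub_le _ _

theorem spectralNorm₂_smul {M w : ℕ} (c : ℝ) (A : Matrix (Fin M) (Fin w) ℝ) :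
    spectralNorm₂ (c • A) = |c| * spectralNorm₂ A := by
  unfold spectralNorm₂
  rw [map_smul, map_smul, norm_smul, Real.norm_eq_abs]

theorem spectralNorm₂_of_columns_le {M w : ℕ} (c : Fin w → EuclideanSpace ℝ (Fin M)) {b : ℝ}
    (hc : ∀ j, ‖c j‖ ≤ b) : spectralNorm₂ (Matrix.of fun i j => c j i) ≤ b * √(w : ℝ) := by
  have hb : 0 ≤ b * √(w : ℝ) := by
    rcases Nat.eq_zero_or_pos w with rfl | hw
    · simp
    · exact mul_nonneg ((norm_nonneg _).trans (hc ⟨0, hw⟩)) (Real.sqrt_nonneg _)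
  refine ContinuousLinearMap.opNorm_le_bound _ hb fun v => ?_
  have hv : Matrix.toEuclideanLin (Matrix.of fun i j => c j i) v = ∑ j, v j • c j := by
    ext i
    simp [Matrix.toLpLin_apply, Matrix.mulVec, dotProduct, mul_comm]
  rw [LinearMap.coe_toContinuousLinearMap', hv]
  calc ‖∑ j, v j • c j‖ ≤ ∑ j, b * (1 * |v j|) := by
        refine (norm_sum_le _ _).trans (Finset.sum_le_sum fun j _ => ?_)
        rw [norm_smul, Real.norm_eq_abs, one_mul, mul_comm]
        exact mul_le_mul_of_nonneg_right (hc j) (abs_nonneg _)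
    _ = b * ∑ j, 1 * |v j| := by rw [Finset.mul_sum]
    _ ≤ b * (√(w : ℝ) * ‖v‖) := by
        rcases Nat.eq_zero_or_pos w with rfl | hw
        · simp
        refine mul_le_mul_of_nonneg_left ?_ ((norm_nonneg _).trans (hc ⟨0, hw⟩))
        rw [EuclideanSpace.norm_eq]
        simpa using Real.sum_mul_le_sqrt_mul_sqrt Finset.univ (fun _ => (1 : ℝ)) fun j => |v j|
    _ = b * √(w : ℝ) * ‖v‖ := by ring

theorem spectralNorm₂_eq_zero_of_isEmpty {M w : ℕ} (h : IsEmpty (Fin M) ∨ IsEmpty (Fin w))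
    (A : Matrix (Fin M) (Fin w) ℝ) : spectralNorm₂ A = 0 := by
  have : A = 0 := by
    ext i j
    rcases h with h | h
    · exact h.elim i
    · exact h.elim j
  simp [this, spectralNorm₂]

theorem continuous_spectralNorm₂_of (M w : ℕ) :
    Continuous fun ξ : Fin M × Fin w → ℝ => spectralNorm₂ (Matrix.of fun i j => ξ (i, j)) := by
  let f : (Fin M × Fin w → ℝ) →ₗ[ℝ] Matrix (Fin M) (Fin w) ℝ :=
    { toFun := fun ξ => Matrix.of fun i j => ξ (i, j)
      map_add' := fun _ _ => rfl
      map_smul' := fun _ _ => rfl }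
  let g := LinearMap.toContinuousLinearMap.toLinearMap ∘ₗ
    (Matrix.toEuclideanLin (𝕜 := ℝ) (m := Fin M) (n := Fin w)).toLinearMap ∘ₗ f
  exact (LinearMap.continuous_of_finiteDimensional g).norm

/-- The Davidson–Szarek tail bound, degenerate dimensions included. -/
theorem measureReal_le_spectralNorm₂' (M w : ℕ) {τ : ℝ} (hτ : 0 < τ) :
    (stdGaussianPi (Fin M × Fin w)).real
        {ξ | √(M : ℝ) + √(w : ℝ) + τ ≤ spectralNorm₂ (Matrix.of fun i j => ξ (i, j))} ≤
      Real.exp (-(τ ^ 2 / 2)) := by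
  rcases isEmpty_or_nonempty (Fin M) with hM | hM
  · have h : ¬ √(M : ℝ) + √(w : ℝ) + τ ≤ 0 := not_le.2 (by positivity)
    simp [spectralNorm₂_eq_zero_of_isEmpty (.inl hM), h, Real.exp_nonneg]
  rcases isEmpty_or_nonempty (Fin w) with hw | hw
  · have h : ¬ √(M : ℝ) + √(w : ℝ) + τ ≤ 0 := not_le.2 (by positivity)
    simp [spectralNorm₂_eq_zero_of_isEmpty (.inr hw), h, Real.exp_nonneg]
  exact measureReal_le_spectralNorm₂ hτ

/-- Distinct normalized noise entries form a standard Gaussian vector. -/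
theorem IsWhiteGaussianNoise.hasLaw_div {Ω : Type*} [MeasurableSpace Ω] {P : Measure Ω}
    [IsProbabilityMeasure P] {M : ℕ} {ti tf : ℤ} {ν : ℝ} (hν : 0 < ν)
    {e : ℤ → Ω → EuclideanSpace ℝ (Fin M)} (he : IsWhiteGaussianNoise P ti tf ν e)
    {κ : Type*} [Fintype κ] {g : κ → Set.Icc ti tf × Fin M} (hg : Function.Injective g) :
    HasLaw (fun ω k => e (g k).1 ω (g k).2 / ν) (stdGaussianPi κ) P := by
  have hlaw : ∀ k, HasLaw (fun ω => e (g k).1 ω (g k).2 / ν) (gaussianReal 0 1) P := by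
    intro k
    have h := gaussianReal_div_const (he.hasLaw (g k).1 (g k).1.2 (g k).2) ν
    have hv : (ν ^ 2).toNNReal / .mk (ν ^ 2) (sq_nonneg ν) = 1 := by
      rw [Real.toNNReal_of_nonneg (sq_nonneg ν)]
      refine div_self fun h => ?_
      exact (pow_pos hν 2).ne' (congrArg NNReal.toReal h)
    rwa [zero_div, hv] at h
  have hind : iIndepFun (fun k ω => e (g k).1 ω (g k).2 / ν) P :=
    (he.indep.precomp hg).comp (fun _ s => s / ν) fun _ => by fun_prop
  have hm : ∀ k, AEMeasurable (fun ω => e (g k).1 ω (g k).2 / ν) P := fun k => (hlaw k).aemeasurable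
  refine ⟨aemeasurable_pi_lambda _ hm, ?_⟩
  rw [(iIndepFun_iff_map_fun_eq_pi_map hm).1 hind]
  congr 1
  exact funext fun k => (hlaw k).map_eq

/-- Before the attack, the history matrix is a matrix with small columns minus the matrix of the
past noise vectors. -/
theorem sigmaOne_historyMatrix_le {M N : ℕ} (H : Matrix (Fin M) (Fin N) ℝ)
    (a : EuclideanSpace ℝ (Fin M)) {ta t : ℤ} (hta : t < ta) (w : ℕ)
    (x : ℤ → EuclideanSpace ℝ (Fin N)) (e : ℤ → EuclideanSpace ℝ (Fin M)) {γ : ℝ}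
    (hx : ∀ j : Fin w, ‖x t - x (t - ((j : ℕ) + 1 : ℤ))‖ ≤ γ) :
    sigmaOne (historyMatrix (measurement H a ta x e) w t) ≤
      (spectralNorm₂ H * γ + ‖e t‖) * √(w : ℝ) +
        spectralNorm₂ (Matrix.of fun i (j : Fin w) => e (t - ((j : ℕ) + 1 : ℤ)) i) := by
  refine (sigmaOne_le_spectralNorm₂ _).trans ?_
  have hdec : historyMatrix (measurement H a ta x e) w t =
      Matrix.of (fun i (j : Fin w) =>
        (Matrix.toEuclideanLin H (x t - x (t - ((j : ℕ) + 1 : ℤ))) + e t) i) -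
      Matrix.of fun i (j : Fin w) => e (t - ((j : ℕ) + 1 : ℤ)) i := by
    ext i j
    have hj : t - ((j : ℕ) + 1 : ℤ) < ta := by omega
    simp only [historyMatrix, measurement, attackIndicator, hta, hj, if_true, zero_smul, sub_zero,
      Matrix.of_apply, Matrix.sub_apply, map_sub, PiLp.sub_apply, PiLp.add_apply,
      PiLp.zero_apply]
    ring
  rw [hdec]
  refine (spectralNorm₂_sub_le _ _).trans (add_le_add_left ?_ _)
  refine spectralNorm₂_of_columns_le
    (fun j : Fin w => Matrix.toEuclideanLin H (x t - x (t - ((j : ℕ) + 1 : ℤ))) + e t)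
    fun j => (norm_add_le _ _).trans (add_le_add_left ?_ _)
  exact ((LinearMap.toContinuousLinearMap (Matrix.toEuclideanLin H)).le_opNorm _).trans
    (mul_le_mul_of_nonneg_left (hx j) (norm_nonneg _))

theorem theorem1 {Ω : Type*} [MeasurableSpace Ω] (P : Measure Ω) [IsProbabilityMeasure P]
    {M N : ℕ} (w : ℕ) (H : Matrix (Fin M) (Fin N) ℝ) (a : EuclideanSpace ℝ (Fin M))
    (ti tf ta : ℤ) (ν γ τ ε : ℝ) (hν : 0 < ν) (hτ : 0 < τ) (hε : 0 < ε)
    (x : ℤ → Ω → EuclideanSpace ℝ (Fin N)) (e : ℤ → Ω → EuclideanSpace ℝ (Fin M))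
    (hxm : ∀ s ∈ Set.Icc ti tf, AEMeasurable (x s) P)
    (hx : HasBoundedVariations P ti tf γ x)
    (he : IsWhiteGaussianNoise P ti tf ν e)
    (t : ℤ) (htw : ti + (w : ℤ) ≤ t) (htf : t ≤ tf) (hta : t < ta) :
    P.real {ω | detectionThreshold H w ν γ τ ε ≤
        sigmaOne (historyMatrix
          (measurement H a ta (fun s => x s ω) (fun s => e s ω)) w t)} ≤
      2 * Real.exp (-(τ ^ 2 / 2)) + ((1 + ε) * Real.exp (-ε)) ^ ((M : ℝ) / 2) := by
  have ht : t ∈ Set.Icc ti tf := ⟨by omega, htf⟩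
  have htj : ∀ j : Fin w, t - ((j : ℕ) + 1 : ℤ) ∈ Set.Icc ti tf := fun j => by
    have := j.2
    constructor <;> omega
  have hlaw₁ := he.hasLaw_div hν (g := fun i : Fin M => (⟨t, ht⟩, i))
    fun i j h => (Prod.ext_iff.1 h).2
  have hlaw₂ := he.hasLaw_div hν
    (g := fun k : Fin M × Fin w => (⟨t - ((k.2 : ℕ) + 1 : ℤ), htj k.2⟩, k.1)) (by
      rintro ⟨i, j⟩ ⟨i', j'⟩ h
      obtain ⟨h1, h2⟩ := Prod.ext_iff.1 h
      have h3 := congrArg Subtype.val h1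
      simp only at h2 h3
      exact Prod.ext h2 (Fin.ext (show (j : ℕ) = j' by omega)))
  have hP₁ := hlaw₁.measureReal_eq (p := fun ξ => (M : ℝ) * (1 + ε) ≤ ∑ i, ξ i ^ 2)
    (measurableSet_le measurable_const (by fun_prop))
  have hP₂ := hlaw₂.measureReal_eq (p := fun ξ => √(M : ℝ) + √(w : ℝ) + τ ≤
      spectralNorm₂ (Matrix.of fun i j => ξ (i, j)))
    (measurableSet_le measurable_const (continuous_spectralNorm₂_of M w).measurable)
  have hb₁ := measureReal_card_mul_le_sum_sq (κ := Fin M) hε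
  rw [Fintype.card_fin, ← hP₁] at hb₁
  have hb₂ := measureReal_le_spectralNorm₂' M w hτ
  rw [← hP₂] at hb₂
  have hxa : ∀ᵐ ω ∂P, ∀ j : Fin w, ‖x t ω - x (t - ((j : ℕ) + 1 : ℤ)) ω‖ ≤ γ :=
    ae_all_iff.2 fun j => hx t ht _ (htj j)
  refine (ENNReal.toReal_mono (measure_ne_top P _) (measure_mono_ae ?_)).trans
    ((measureReal_union_le _ _).trans ((add_le_add hb₂ hb₁).trans ?_))
  · filter_upwards [hxa] with ω hω hℓ
    by_contra hcon
    obtain ⟨h2, h1⟩ := not_or.1 hcon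
    replace h1 : ∑ i, (e t ω i / ν) ^ 2 < M * (1 + ε) := not_le.1 h1
    replace h2 : spectralNorm₂ (Matrix.of fun i (j : Fin w) =>
      e (t - ((j : ℕ) + 1 : ℤ)) ω i / ν) < √(M : ℝ) + √(w : ℝ) + τ := not_le.1 h2
    have hE : spectralNorm₂ (Matrix.of fun i (j : Fin w) => e (t - ((j : ℕ) + 1 : ℤ)) ω i) =
        ν * spectralNorm₂ (Matrix.of fun i (j : Fin w) =>
          e (t - ((j : ℕ) + 1 : ℤ)) ω i / ν) := by
      rw [← abs_of_pos hν, ← spectralNorm₂_smul, abs_of_pos hν]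
      congr 1
      ext i j
      simp [mul_div_cancel₀ _ hν.ne']
    -- The chi-square bound holds at level `1 + ε` for the square, while the threshold has
    -- `1 + ε` in front of the norm itself.
    have het : ‖e t ω‖ ≤ ν * (√(M : ℝ) * (1 + ε)) := by
      rw [EuclideanSpace.norm_eq]
      refine Real.sqrt_le_iff.2 ⟨by positivity, ?_⟩
      simp only [div_pow, ← Finset.sum_div] at h1
      rw [div_lt_iff₀ (by positivity)] at h1
      simp only [Real.norm_eq_abs, sq_abs]
      rw [mul_pow, mul_pow, Real.sq_sqrt (Nat.cast_nonneg M)]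
      have : (M : ℝ) * (1 + ε) * ν ^ 2 ≤ M * (1 + ε) ^ 2 * ν ^ 2 := by
        gcongr
        nlinarith
      linarith
    have hσ := sigmaOne_historyMatrix_le H a hta w (fun s => x s ω) (fun s => e s ω) hω
    have hw := mul_le_mul_of_nonneg_right het (Real.sqrt_nonneg (w : ℝ))
    have h3 := mul_lt_mul_of_pos_left h2 hν
    replace hℓ : detectionThreshold H w ν γ τ ε ≤ sigmaOne (historyMatrix
      (measurement H a ta (fun s => x s ω) (fun s => e s ω)) w t) := hℓ
    rw [detectionThreshold] at hℓ
    rw [hE] at hσ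
    linarith
  · linarith [Real.exp_pos (-(τ ^ 2 / 2))]
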